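/- Let $(M,J,g)$ be an almost complex manifold with Norden metric of dimension $2n$: $M$ is a smooth $2n$-dimensional manifold, $J$ is a smooth field of endomorphisms of the tangent spaces with $J^2=-\mathrm{id}$, and $g$ is a smooth pseudo-Riemannian metric with $g(JX,JY)=-g(X,Y)$ for all vector fields $X,Y$. Let $\nabla$ be the Levi-Civita connection of $g$, let $R(X,Y)Z=\nabla_X\nabla_YZ-\nabla_Y\nabla_XZ-\nabla_{[X,Y]}Z$ and $R(X,Y,Z,U)=g(R(X,Y)Z,U)$, and let $F(X,Y,Z)=g\bigl((\nabla_XJ)Y,Z\bigr)$. Then, for all smooth vector fields $X,Y,Z,U$ (defined on $M$ or only near the point considered), (i) $R(X,Y,JZ,U)-R(X,Y,Z,JU)=(\nabla_XF)(Y,Z,U)-(\nabla_YF)(X,Z,U)$; (ii) $(\nabla_XF)(Y,JZ,U)+(\nabla_XF)(Y,Z,JU)=-g\bigl((\nabla_XJ)Z,(\nabla_YJ)U\bigr)-g\bigl((\nabla_XJ)U,(\nabla_YJ)Z\bigr)$; (iii) $(\nabla_XF)(Y,Z,U)=(\nabla_XF)(Y,U,Z)$; and, for every point $p\in M$, every basis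 $\{e_i\}_{i=1}^{2n}$ of $T_pM$ and all $z,u\in T_pM$, with $(g^{ij})$ the inverse of the matrix $\bigl(g(e_i,e_j)\bigr)$ and summation over repeated indices, (iv) $g^{ij}(\nabla_{e_i}F)(e_j,Jz,u)+g^{ij}(\nabla_{e_i}F)(e_j,z,Ju)=-2\,g^{ij}g\bigl((\nabla_{e_i}J)z,(\nabla_{e_j}J)u\bigr)$. -/

import Mathlib

open Bundle
open scoped Manifold ContDiff

/-- A vector field on an `m`-manifold (no regularity is assumed). -/
abbrev VField (m : ℕ) (M : Type*) [TopologicalSpace M]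
    [ChartedSpace (EuclideanSpace ℝ (Fin m)) M] : Type _ :=
  (p : M) → TangentSpace (𝓡 m) p

/-- The vector field `X` is differentiable at `p`. -/
abbrev DiffAt {m : ℕ} {M : Type*} [TopologicalSpace M]
    [ChartedSpace (EuclideanSpace ℝ (Fin m)) M] [IsManifold (𝓡 m) ∞ M]
    (X : VField m M) (p : M) : Prop :=
  MDifferentiableAt (𝓡 m) ((𝓡 m).prod 𝓘(ℝ, EuclideanSpace ℝ (Fin m)))
    (fun q ↦ TotalSpace.mk' (EuclideanSpace ℝ (Fin m)) (E := fun q : M ↦ TangentSpace (𝓡 m) q)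
      q (X q)) p

/-- The vector field `X` is smooth near `p`; it need not be smooth, or meaningful, elsewhere. -/
abbrev SmoothNear {m : ℕ} {M : Type*} [TopologicalSpace M]
    [ChartedSpace (EuclideanSpace ℝ (Fin m)) M] [IsManifold (𝓡 m) ∞ M]
    (X : VField m M) (p : M) : Prop :=
  ContMDiffAt (𝓡 m) ((𝓡 m).prod 𝓘(ℝ, EuclideanSpace ℝ (Fin m))) ∞
    (fun q ↦ TotalSpace.mk' (EuclideanSpace ℝ (Fin m)) (E := fun q : M ↦ TangentSpace (𝓡 m) q)
      q (X q)) p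

/-- A pseudo-Riemannian metric (of arbitrary signature) on a smooth `m`-manifold: a smooth field
of nondegenerate symmetric bilinear forms on the tangent spaces. -/
structure PseudoRiemannianMetric (m : ℕ) (M : Type*) [TopologicalSpace M]
    [ChartedSpace (EuclideanSpace ℝ (Fin m)) M] [IsManifold (𝓡 m) ∞ M] where
  /-- the bilinear form on the tangent space at `p` -/
  form (p : M) : TangentSpace (𝓡 m) p →L[ℝ] TangentSpace (𝓡 m) p →L[ℝ] ℝ
  symm (p : M) (v w : TangentSpace (𝓡 m) p) : form p v w = form p w v
  nondegenerate (p : M) (v : TangentSpace (𝓡 m) p) : (∀ w, form p v w = 0) → v = 0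
  smooth : ContMDiff (𝓡 m)
    ((𝓡 m).prod 𝓘(ℝ, EuclideanSpace ℝ (Fin m) →L[ℝ] EuclideanSpace ℝ (Fin m) →L[ℝ] ℝ)) ∞
    (fun p ↦ TotalSpace.mk' (EuclideanSpace ℝ (Fin m) →L[ℝ] EuclideanSpace ℝ (Fin m) →L[ℝ] ℝ)
      (E := fun p : M ↦ TangentSpace (𝓡 m) p →L[ℝ] TangentSpace (𝓡 m) p →L[ℝ] ℝ) p (form p))

/-- An almost complex structure on a smooth `m`-manifold: a smooth field of endomorphisms `J` of
the tangent spaces with `J ∘ J = -1`. -/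
structure AlmostComplexStructure (m : ℕ) (M : Type*) [TopologicalSpace M]
    [ChartedSpace (EuclideanSpace ℝ (Fin m)) M] [IsManifold (𝓡 m) ∞ M] where
  /-- the endomorphism of the tangent space at `p` -/
  endo (p : M) : TangentSpace (𝓡 m) p →L[ℝ] TangentSpace (𝓡 m) p
  sq (p : M) (v : TangentSpace (𝓡 m) p) : endo p (endo p v) = -v
  smooth : ContMDiff (𝓡 m)
    ((𝓡 m).prod 𝓘(ℝ, EuclideanSpace ℝ (Fin m) →L[ℝ] EuclideanSpace ℝ (Fin m))) ∞
    (fun p ↦ TotalSpace.mk' (EuclideanSpace ℝ (Fin m) →L[ℝ] EuclideanSpace ℝ (Fin m))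
      (E := fun p : M ↦ TangentSpace (𝓡 m) p →L[ℝ] TangentSpace (𝓡 m) p) p (endo p))

noncomputable section

variable {m : ℕ} {M : Type*} [TopologicalSpace M]
  [ChartedSpace (EuclideanSpace ℝ (Fin m)) M] [IsManifold (𝓡 m) ∞ M]

/-- The function `g(X, Y)`. -/
def PseudoRiemannianMetric.inner (g : PseudoRiemannianMetric m M) (X Y : VField m M) : M → ℝ :=
  fun p ↦ g.form p (X p) (Y p)

/-- The vector field `J X`. -/
def AlmostComplexStructure.app (J : AlmostComplexStructure m M) (X : VField m M) : VField m M :=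
  fun p ↦ J.endo p (X p)

namespace PseudoRiemannianMetric

variable (g : PseudoRiemannianMetric m M)

theorem inner_comm (X Y : VField m M) : g.inner X Y = g.inner Y X :=
  funext fun p ↦ g.symm p _ _

theorem mdifferentiableAt_inner {X Y : VField m M} {p : M}
    (hX : DiffAt X p) (hY : DiffAt Y p) : MDifferentiableAt (𝓡 m) 𝓘(ℝ) (g.inner X Y) p := by
  have : MDifferentiableAt (𝓡 m) ((𝓡 m).prod 𝓘(ℝ))
      (fun q ↦ TotalSpace.mk' ℝ (E := Bundle.Trivial M ℝ) q (g.form q (X q) (Y q))) p := by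
    apply MDifferentiableAt.clm_bundle_apply₂ (F₁ := EuclideanSpace ℝ (Fin m))
      (F₂ := EuclideanSpace ℝ (Fin m))
    · exact g.smooth.mdifferentiableAt (by simp)
    · exact hX
    · exact hY
  simp only [mdifferentiableAt_totalSpace] at this
  exact this.2

theorem eq_of_form_eq {p : M} {v w : TangentSpace (𝓡 m) p}
    (h : ∀ u, g.form p v u = g.form p w u) : v = w := by
  rw [← sub_eq_zero]
  apply g.nondegenerate p
  intro u
  simp [h u]

/-- The right-hand side of the Koszul formula for `2 g(∇_X Y, Z)`. -/
def koszul (X Y Z : VField m M) (p : M) : ℝ :=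
  mvfderiv (𝓡 m) (g.inner Y Z) p (X p) + mvfderiv (𝓡 m) (g.inner X Z) p (Y p) - mvfderiv (𝓡 m) (g.inner X Y) p (Z p)
    + g.form p (VectorField.mlieBracket (𝓡 m) X Y p) (Z p)
    - g.form p (VectorField.mlieBracket (𝓡 m) X Z p) (Y p)
    - g.form p (VectorField.mlieBracket (𝓡 m) Y Z p) (X p)

theorem inner_smul_left (f : M → ℝ) (X Y : VField m M) :
    g.inner (f • X) Y = f * g.inner X Y := by
  ext p; simp [inner]

theorem inner_smul_right (f : M → ℝ) (X Y : VField m M) :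
    g.inner X (f • Y) = f * g.inner X Y := by
  ext p; simp [inner]

theorem inner_add_left (X X' Y : VField m M) :
    g.inner (X + X') Y = g.inner X Y + g.inner X' Y := by
  ext p; simp [inner]

theorem inner_add_right (X Y Y' : VField m M) :
    g.inner X (Y + Y') = g.inner X Y + g.inner X Y' := by
  ext p; simp [inner]

theorem koszul_tensorial_left {Y Z : VField m M} {p : M} (hY : DiffAt Y p)
    (hZ : DiffAt Z p) :
    TensorialAt (𝓡 m) (EuclideanSpace ℝ (Fin m)) (fun X : VField m M ↦ g.koszul X Y Z p) p where
  smul {f X} hf hX := by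
    have h1 := g.mdifferentiableAt_inner hX hY
    have h2 := g.mdifferentiableAt_inner hX hZ
    simp only [koszul, inner_smul_left, mvfderiv_mul hf h1, mvfderiv_mul hf h2,
      VectorField.mlieBracket_smul_left hf hX]
    simp [inner, g.symm p (X p)]
    ring
  add {X X'} hX hX' := by
    have h1 := g.mdifferentiableAt_inner hX hY
    have h2 := g.mdifferentiableAt_inner hX hZ
    have h1' := g.mdifferentiableAt_inner hX' hY
    have h2' := g.mdifferentiableAt_inner hX' hZ
    simp only [koszul, inner_add_left, mvfderiv_add h1 h1', mvfderiv_add h2 h2',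
      VectorField.mlieBracket_add_left hX hX']
    simp
    ring

theorem koszul_tensorial_right {X Y : VField m M} {p : M} (hX : DiffAt X p)
    (hY : DiffAt Y p) :
    TensorialAt (𝓡 m) (EuclideanSpace ℝ (Fin m)) (fun Z : VField m M ↦ g.koszul X Y Z p) p where
  smul {f Z} hf hZ := by
    have h1 := g.mdifferentiableAt_inner hX hZ
    have h2 := g.mdifferentiableAt_inner hY hZ
    simp only [koszul, inner_smul_right, mvfderiv_mul hf h1, mvfderiv_mul hf h2,
      VectorField.mlieBracket_smul_right hf hZ]
    simp [inner, g.symm p (Z p) (X p), g.symm p (Z p) (Y p)]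
    ring
  add {Z Z'} hZ hZ' := by
    have h1 := g.mdifferentiableAt_inner hX hZ
    have h2 := g.mdifferentiableAt_inner hY hZ
    have h1' := g.mdifferentiableAt_inner hX hZ'
    have h2' := g.mdifferentiableAt_inner hY hZ'
    simp only [koszul, inner_add_right, mvfderiv_add h1 h1', mvfderiv_add h2 h2',
      VectorField.mlieBracket_add_right hZ hZ']
    simp
    ring

theorem koszul_add {X Y Y' Z : VField m M} {p : M} (hX : DiffAt X p)
    (hY : DiffAt Y p) (hY' : DiffAt Y' p) (hZ : DiffAt Z p) :
    g.koszul X (Y + Y') Z p = g.koszul X Y Z p + g.koszul X Y' Z p := by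
  have h1 := g.mdifferentiableAt_inner hX hY
  have h2 := g.mdifferentiableAt_inner hY hZ
  have h1' := g.mdifferentiableAt_inner hX hY'
  have h2' := g.mdifferentiableAt_inner hY' hZ
  simp only [koszul, inner_add_left, inner_add_right, mvfderiv_add h1 h1', mvfderiv_add h2 h2',
    VectorField.mlieBracket_add_left hY hY', VectorField.mlieBracket_add_right hY hY']
  simp
  ring

theorem koszul_leibniz {X Y Z : VField m M} {f : M → ℝ} {p : M} (hX : DiffAt X p)
    (hY : DiffAt Y p) (hZ : DiffAt Z p) (hf : MDifferentiableAt (𝓡 m) 𝓘(ℝ) f p) :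
    g.koszul X (f • Y) Z p
      = f p * g.koszul X Y Z p + 2 * (mvfderiv (𝓡 m) f p (X p) * g.form p (Y p) (Z p)) := by
  have h1 := g.mdifferentiableAt_inner hX hY
  have h2 := g.mdifferentiableAt_inner hY hZ
  simp only [koszul, inner_smul_left, inner_smul_right, mvfderiv_mul hf h1, mvfderiv_mul hf h2,
    VectorField.mlieBracket_smul_left hf hY, VectorField.mlieBracket_smul_right hf hY]
  simp [inner, g.symm p (Y p) (X p)]
  ring

/-- For `Y` differentiable at `p`, the Koszul formula determines the endomorphism
`v ↦ ∇_v Y` of the tangent space at `p`. -/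
theorem exists_koszul {Y : VField m M} {p : M} (hY : DiffAt Y p) :
    ∃ A : TangentSpace (𝓡 m) p →L[ℝ] TangentSpace (𝓡 m) p,
      ∀ X Z : VField m M, DiffAt X p → DiffAt Z p →
        2 * g.form p (A (X p)) (Z p) = g.koszul X Y Z p := by
  let B : TangentSpace (𝓡 m) p →L[ℝ] TangentSpace (𝓡 m) p →L[ℝ] ℝ :=
    TensorialAt.mkHom₂ (fun X Z : VField m M ↦ g.koszul X Y Z p) p
      (fun _ hZ ↦ g.koszul_tensorial_left hY hZ) (fun _ hX ↦ g.koszul_tensorial_right hX hY)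
  have : FiniteDimensional ℝ (TangentSpace (𝓡 m) p) :=
    inferInstanceAs (FiniteDimensional ℝ (EuclideanSpace ℝ (Fin m)))
  have : T2Space (TangentSpace (𝓡 m) p) := inferInstanceAs (T2Space (EuclideanSpace ℝ (Fin m)))
  let G : LinearMap.BilinForm ℝ (TangentSpace (𝓡 m) p) :=
    LinearMap.mk₂ ℝ (fun v w ↦ g.form p v w) (by simp) (by simp) (by simp) (by simp)
  have hG : G.Nondegenerate := by
    refine ⟨fun v hv ↦ g.nondegenerate p v hv, fun v hv ↦ g.nondegenerate p v fun w ↦ ?_⟩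
    rw [g.symm]; exact hv w
  let L : TangentSpace (𝓡 m) p →ₗ[ℝ] Module.Dual ℝ (TangentSpace (𝓡 m) p) :=
    LinearMap.mk₂ ℝ (fun v w ↦ 2⁻¹ * B v w) (by simp [mul_add]) (by simp; intros; ring)
      (by simp [mul_add]) (by simp; intros; ring)
  refine ⟨LinearMap.toContinuousLinearMap ((LinearMap.BilinForm.toDual G hG).symm.toLinearMap ∘ₗ L),
    fun X Z hX hZ ↦ ?_⟩
  have h1 : g.form p ((LinearMap.BilinForm.toDual G hG).symm (L (X p))) (Z p) = L (X p) (Z p) :=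
    LinearMap.BilinForm.apply_toDual_symm_apply (hB := hG) (L (X p)) (Z p)
  have h2 : B (X p) (Z p) = g.koszul X Y Z p := TensorialAt.mkHom₂_apply _ _ hX hZ
  have h3 : L (X p) (Z p) = 2⁻¹ * B (X p) (Z p) := rfl
  simp only [LinearMap.coe_toContinuousLinearMap', LinearMap.comp_apply]
  erw [h1, h3, h2]
  ring

open Classical in
/-- The map `v ↦ ∇_v Y` on the tangent space at `p`, as determined by the Koszul formula; it is
set to `0` if `Y` is not differentiable at `p`. -/
def nablaAt (Y : VField m M) (p : M) : TangentSpace (𝓡 m) p →L[ℝ] TangentSpace (𝓡 m) p :=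
  if hY : DiffAt Y p then (g.exists_koszul hY).choose else 0

theorem two_mul_form_nablaAt {X Y Z : VField m M} {p : M} (hX : DiffAt X p)
    (hY : DiffAt Y p) (hZ : DiffAt Z p) :
    2 * g.form p (g.nablaAt Y p (X p)) (Z p) = g.koszul X Y Z p := by
  rw [nablaAt, dif_pos hY]
  exact (g.exists_koszul hY).choose_spec X Z hX hZ

theorem nablaAt_eq {Y : VField m M} {p : M} (hY : DiffAt Y p)
    (A : TangentSpace (𝓡 m) p →L[ℝ] TangentSpace (𝓡 m) p)
    (hA : ∀ X Z : VField m M, DiffAt X p → DiffAt Z p →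
      2 * g.form p (A (X p)) (Z p) = g.koszul X Y Z p) : g.nablaAt Y p = A := by
  ext1 v
  apply g.eq_of_form_eq
  intro w
  have hv := FiberBundle.mdifferentiableAt_extend (𝓡 m) (EuclideanSpace ℝ (Fin m)) v
  have hw := FiberBundle.mdifferentiableAt_extend (𝓡 m) (EuclideanSpace ℝ (Fin m)) w
  have h1 := g.two_mul_form_nablaAt hv hY hw
  have h2 := hA _ _ hv hw
  simp only [FiberBundle.extend_apply_self] at h1 h2
  linarith

/-- The Levi-Civita connection of a pseudo-Riemannian metric. The vector
`g.leviCivita Y p (X p)` is the value of `∇_X Y` at `p`. -/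
def leviCivita : CovariantDerivative (𝓡 m) (EuclideanSpace ℝ (Fin m))
    (TangentSpace (𝓡 m) : M → Type _) where
  toFun := g.nablaAt
  isCovariantDerivativeOnUniv :=
    { add := by
        intro Y Y' p hY hY' _
        apply g.nablaAt_eq (mdifferentiableAt_add_section hY hY')
        intro X Z hX hZ
        rw [g.koszul_add hX hY hY' hZ, ← g.two_mul_form_nablaAt hX hY hZ,
          ← g.two_mul_form_nablaAt hX hY' hZ]
        simp
        ring
      leibniz := by
        intro Y f p hY hf _
        apply g.nablaAt_eq (hf.smul_section hY)
        intro X Z hX hZ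
        rw [g.koszul_leibniz hX hY hZ hf, ← g.two_mul_form_nablaAt hX hY hZ]
        simp
        ring }

/-- The Levi-Civita connection is torsion free. -/
theorem torsion_leviCivita : g.leviCivita.torsion = 0 := by
  rw [CovariantDerivative.torsion_eq_zero_iff]
  intro X Y p hX hY
  apply g.eq_of_form_eq
  intro w
  have hw := FiberBundle.mdifferentiableAt_extend (𝓡 m) (EuclideanSpace ℝ (Fin m)) w
  have h1 := g.two_mul_form_nablaAt hX hY hw
  have h2 := g.two_mul_form_nablaAt hY hX hw
  simp only [koszul, VectorField.mlieBracket_swap_apply (V := Y) (W := X), g.inner_comm Y X,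
    FiberBundle.extend_apply_self, map_neg, neg_apply] at h1 h2
  have h3 : ∀ Z : VField m M, g.leviCivita Z p = g.nablaAt Z p := fun _ ↦ rfl
  rw [h3, h3, map_sub, sub_apply]
  linarith

/-- The Levi-Civita connection is metric. -/
theorem metric_leviCivita {X Y Z : VField m M} {p : M} (hX : DiffAt X p)
    (hY : DiffAt Y p) (hZ : DiffAt Z p) :
    mvfderiv (𝓡 m) (g.inner Y Z) p (X p)
      = g.form p (g.leviCivita Y p (X p)) (Z p) + g.form p (Y p) (g.leviCivita Z p (X p)) := by
  have h1 := g.two_mul_form_nablaAt hX hY hZ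
  have h2 := g.two_mul_form_nablaAt hX hZ hY
  have h3 : ∀ Z : VField m M, g.leviCivita Z p = g.nablaAt Z p := fun _ ↦ rfl
  rw [h3, h3, g.symm p (Y p)]
  simp only [koszul, g.inner_comm Z Y, VectorField.mlieBracket_swap_apply (V := Z) (W := Y),
    map_neg, neg_apply] at h1 h2
  linarith

/-- The vector field `∇_X Y`, for the Levi-Civita connection `∇` of `g`. -/
def nabla (X Y : VField m M) : VField m M :=
  fun p ↦ g.leviCivita Y p (X p)

/-- The curvature `R(X, Y) Z = ∇_X ∇_Y Z - ∇_Y ∇_X Z - ∇_{[X, Y]} Z`. -/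
def curvature (X Y Z : VField m M) : VField m M :=
  g.nabla X (g.nabla Y Z) - g.nabla Y (g.nabla X Z)
    - g.nabla (VectorField.mlieBracket (𝓡 m) X Y) Z

/-- The curvature as a covariant tensor, `R(X, Y, Z, U) = g(R(X, Y) Z, U)`. -/
def curvature4 (X Y Z U : VField m M) : M → ℝ :=
  g.inner (g.curvature X Y Z) U

/-- The inverse `g^{ij}` of the matrix `g(e_i, e_j)`, for a basis `e` of the tangent space
at `p`. -/
def inverseGram {ι : Type*} [Fintype ι] [DecidableEq ι] (p : M)
    (e : Module.Basis ι ℝ (TangentSpace (𝓡 m) p)) : Matrix ι ι ℝ :=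
  (Matrix.of fun i j ↦ g.form p (e i) (e j))⁻¹

variable (J : AlmostComplexStructure m M)

/-- `g` is a Norden metric with respect to `J`: `g(JX, JY) = -g(X, Y)`. -/
def IsNorden : Prop :=
  ∀ (p : M) (v w : TangentSpace (𝓡 m) p), g.form p (J.endo p v) (J.endo p w) = -g.form p v w

/-- The vector field `(∇_X J) Y = ∇_X (J Y) - J (∇_X Y)`. -/
def nablaJ (X Y : VField m M) : VField m M :=
  g.nabla X (J.app Y) - J.app (g.nabla X Y)

/-- The tensor `F(X, Y, Z) = g((∇_X J) Y, Z)`. -/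
def tensorF (X Y Z : VField m M) : M → ℝ :=
  g.inner (g.nablaJ J X Y) Z

/-- The covariant derivative `(∇_X F)(Y, Z, U)` of the tensor `F`, that is
`X (F(Y, Z, U)) - F(∇_X Y, Z, U) - F(Y, ∇_X Z, U) - F(Y, Z, ∇_X U)`. -/
def nablaF (X Y Z U : VField m M) : M → ℝ :=
  fun p ↦ mvfderiv (𝓡 m) (g.tensorF J Y Z U) p (X p)
    - g.tensorF J (g.nabla X Y) Z U p
    - g.tensorF J Y (g.nabla X Z) U p
    - g.tensorF J Y Z (g.nabla X U) p

end PseudoRiemannianMetric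
end

/-! Everything is read off the second covariant derivative `nablaNablaJ` of J. Since ∇ is metric,
(∇_X F)(Y,Z,U) = g((∇²_{X,Y} J)Z, U) (`nablaF_eq`). Antisymmetrizing in X, Y gives the commutator of
R(X,Y) with J (Ricci identity), and J is g-self-adjoint because the metric is Norden: this is (i).
Differentiating J² = -1 twice gives (∇²_{X,Y} J)J + J(∇²_{X,Y} J) = -(∇_X J)(∇_Y J) - (∇_Y J)(∇_X
J); pairing with U and using that each ∇_X J is self-adjoint gives (ii). That self-adjointness,
differentiated once more, is (iii), and contracting (ii) with the symmetric g^{ij} gives (iv).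

The analytic point is that the outer derivative in ∇_X(∇_Y Z) obeys its rules only on differentiable
fields, so ∇_Y Z must be shown differentiable (`diffAt_nabla`). The Koszul formula makes the
products g(∇_Y Z, W) differentiable, and Cramer's rule for the Gram matrix of a local frame recovers
the coefficients of ∇_Y Z. -/

/-- Cramer's rule with differentiable coefficients. -/
theorem mdifferentiableAt_of_mulVec_eq {m : ℕ} {M : Type*} [TopologicalSpace M]
    [ChartedSpace (EuclideanSpace ℝ (Fin m)) M] {ι : Type} [Fintype ι] [DecidableEq ι]
    {A : M → Matrix ι ι ℝ} {c k : M → ι → ℝ} {p : M}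
    (hA : ∀ i j, MDifferentiableAt (𝓡 m) 𝓘(ℝ) (fun q ↦ A q i j) p)
    (hk : ∀ i, MDifferentiableAt (𝓡 m) 𝓘(ℝ) (fun q ↦ k q i) p)
    (hdet : (A p).det ≠ 0) (h : ∀ᶠ q in nhds p, (A q).mulVec (c q) = k q) (i : ι) :
    MDifferentiableAt (𝓡 m) 𝓘(ℝ) (fun q ↦ c q i) p := by
  have det_diff {B : M → Matrix ι ι ℝ}
      (hB : ∀ i j, MDifferentiableAt (𝓡 m) 𝓘(ℝ) (fun q ↦ B q i j) p) :
      MDifferentiableAt (𝓡 m) 𝓘(ℝ) (fun q ↦ (B q).det) p := by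
    have : (fun q ↦ (B q).det) = ∑ σ : Equiv.Perm ι, ((Equiv.Perm.sign σ : ℤ) : ℝ) •
        ∏ i, fun q ↦ B q (σ i) i := by
      ext q
      simp [Matrix.det_apply', Finset.sum_apply, Finset.prod_apply]
    rw [this]
    exact .sum fun (σ : Equiv.Perm ι) _ ↦
      (MDifferentiableAt.prod fun i _ ↦ hB (σ i) i).const_smul _
  have hd := det_diff hA
  have hc : MDifferentiableAt (𝓡 m) 𝓘(ℝ)
      (fun q ↦ ((A q).det)⁻¹ * ((A q).cramer (k q) i)) p := by
    refine MDifferentiableAt.mul ?_ ?_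
    · exact DifferentiableAt.comp_mdifferentiableAt (g := fun x : ℝ ↦ x⁻¹) (f := fun q ↦ (A q).det)
        (differentiableAt_inv hdet) hd
    · simp only [Matrix.cramer_apply]
      refine det_diff fun a b ↦ ?_
      by_cases hb : b = i
      · subst hb; simpa using hk a
      · simpa [Matrix.updateCol_ne hb] using hA a b
  refine hc.congr_of_eventuallyEq ?_
  filter_upwards [h, hd.continuousAt.eventually_ne hdet] with q hq hq0
  rw [← hq, Matrix.cramer_eq_adjugate_mulVec, Matrix.mulVec_mulVec, Matrix.adjugate_mul,
    Matrix.smul_mulVec, Matrix.one_mulVec]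
  simp [hq0]

/-! ### Differentiability of ∇_X Y. -/

section

theorem two_le_infty : (2 : WithTop ℕ∞) ≤ ∞ := WithTop.coe_le_coe.2 le_top

variable {m : ℕ} {M : Type*} [TopologicalSpace M]
  [ChartedSpace (EuclideanSpace ℝ (Fin m)) M] [IsManifold (𝓡 m) ∞ M]

/-- The vector field `X` is `C^k` at `p`. -/
abbrev SectionContMDiffAt (k : WithTop ℕ∞) (X : VField m M) (p : M) : Prop :=
  ContMDiffAt (𝓡 m) ((𝓡 m).prod 𝓘(ℝ, EuclideanSpace ℝ (Fin m))) k
    (fun q ↦ TotalSpace.mk' (EuclideanSpace ℝ (Fin m)) (E := fun q : M ↦ TangentSpace (𝓡 m) q)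
      q (X q)) p

theorem SmoothNear.of_le {X : VField m M} {p : M} (hX : SmoothNear X p) {k : WithTop ℕ∞}
    (hk : k ≤ ∞) : SectionContMDiffAt k X p :=
  ContMDiffAt.of_le hX hk

theorem SmoothNear.eventually_two {X : VField m M} {p : M} (hX : SmoothNear X p) :
    ∀ᶠ q in nhds p, SectionContMDiffAt 2 X q :=
  have : IsManifold (𝓡 m) 2 M := .of_le (n := ∞) two_le_infty
  (contMDiffAt_iff_contMDiffAt_nhds (by simp)).1 (hX.of_le two_le_infty)

/-- The derivative of a `C^2` function along a `C^1` vector field is `C^1`. -/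
theorem contMDiffAt_mvfderiv_apply {f : M → ℝ} {X : VField m M} {p : M}
    (hf : ContMDiffAt (𝓡 m) 𝓘(ℝ) 2 f p) (hX : SectionContMDiffAt 1 X p) :
    ContMDiffAt (𝓡 m) 𝓘(ℝ) 1 (fun q ↦ mvfderiv (𝓡 m) f q (X q)) p := by
  have h1 := hf.mfderiv_const (m := 1) (by norm_num)
  have h2 := ContMDiffAt.clm_apply_of_inCoordinates (b₁ := id) (b₂ := f)
    (E₁ := fun q : M ↦ TangentSpace (𝓡 m) q) (E₂ := fun y : ℝ ↦ TangentSpace 𝓘(ℝ) y)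
    h1 hX (hf.of_le (by norm_num))
  rw [contMDiffAt_totalSpace] at h2
  simpa using! h2.2

namespace PseudoRiemannianMetric

variable (g : PseudoRiemannianMetric m M)

theorem contMDiffAt_inner {k : WithTop ℕ∞} (hk : k ≤ ∞) {X Y : VField m M} {p : M}
    (hX : SectionContMDiffAt k X p) (hY : SectionContMDiffAt k Y p) :
    ContMDiffAt (𝓡 m) 𝓘(ℝ) k (g.inner X Y) p := by
  have : ContMDiffAt (𝓡 m) ((𝓡 m).prod 𝓘(ℝ)) k
      (fun q ↦ TotalSpace.mk' ℝ (E := Bundle.Trivial M ℝ) q (g.form q (X q) (Y q))) p := by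
    apply ContMDiffAt.clm_bundle_apply₂ (F₁ := EuclideanSpace ℝ (Fin m))
      (F₂ := EuclideanSpace ℝ (Fin m))
    · exact (g.smooth p).of_le hk
    · exact hX
    · exact hY
  simp only [contMDiffAt_totalSpace] at this
  exact this.2

/-- Each term of the Koszul expression costs one derivative, so C² fields leave a C¹ function. -/
theorem mdifferentiableAt_koszul {X Y Z : VField m M} {p : M} (hX : SectionContMDiffAt 2 X p)
    (hY : SectionContMDiffAt 2 Y p) (hZ : SectionContMDiffAt 2 Z p) :
    MDifferentiableAt (𝓡 m) 𝓘(ℝ) (g.koszul X Y Z) p := by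
  have : IsManifold (𝓡 m) (((2 : ℕ∞) : WithTop ℕ∞) + 1) M := .of_le (n := ∞) (by norm_cast)
  have : IsManifold (𝓡 m) (minSmoothness ℝ 2) M :=
    .of_le (n := ∞) (by simpa using two_le_infty)
  have d {V W S : VField m M} (hV : SectionContMDiffAt 2 V p) (hW : SectionContMDiffAt 2 W p)
      (hS : SectionContMDiffAt 2 S p) :
      MDifferentiableAt (𝓡 m) 𝓘(ℝ) (fun q ↦ mvfderiv (𝓡 m) (g.inner V W) q (S q)) p :=
    (contMDiffAt_mvfderiv_apply (g.contMDiffAt_inner two_le_infty hV hW)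
      (hS.of_le (by norm_num))).mdifferentiableAt (by simp)
  have b {V W S : VField m M} (hV : SectionContMDiffAt 2 V p) (hW : SectionContMDiffAt 2 W p)
      (hS : SectionContMDiffAt 2 S p) :
      MDifferentiableAt (𝓡 m) 𝓘(ℝ)
        (fun q ↦ g.form q (VectorField.mlieBracket (𝓡 m) V W q) (S q)) p :=
    g.mdifferentiableAt_inner
      ((ContMDiffAt.mlieBracket_vectorField (m := 1) (n := 2) hV hW
        (by simp [minSmoothness_of_isRCLikeNormedField]; norm_num)).mdifferentiableAt (by simp))
      (hS.mdifferentiableAt (by simp))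
  exact ((((d hY hZ hX).add (d hX hZ hY)).sub (d hX hY hZ)).add (b hX hY hZ)).sub (b hX hZ hY)
    |>.sub (b hY hZ hX)

theorem det_gram_ne_zero {ι : Type*} [Fintype ι] [DecidableEq ι] (p : M)
    (e : Module.Basis ι ℝ (TangentSpace (𝓡 m) p)) :
    (Matrix.of fun i j ↦ g.form p (e i) (e j)).det ≠ 0 := by
  let B : LinearMap.BilinForm ℝ (TangentSpace (𝓡 m) p) :=
    LinearMap.mk₂ ℝ (fun v w ↦ g.form p v w) (by simp) (by simp) (by simp) (by simp)
  have hB : B.Nondegenerate := by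
    refine ⟨fun v hv ↦ g.nondegenerate p v hv, fun v hv ↦ g.nondegenerate p v fun w ↦ ?_⟩
    rw [g.symm]; exact hv w
  convert! (LinearMap.BilinForm.nondegenerate_iff_det_ne_zero e).1 hB
  ext i j
  simp [B]

/-- A vector field is differentiable if its inner products with `C^2` vector fields are. -/
theorem diffAt_of_inner {V : VField m M} {p : M}
    (h : ∀ Z : VField m M, SectionContMDiffAt 2 Z p →
      ∃ f : M → ℝ, MDifferentiableAt (𝓡 m) 𝓘(ℝ) f p ∧ g.inner V Z =ᶠ[nhds p] f) : DiffAt V p := by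
  classical
  let b := (EuclideanSpace.basisFun (Fin m) ℝ).toBasis
  let e := trivializationAt (EuclideanSpace ℝ (Fin m)) (TangentSpace (𝓡 m)) p
  have hp : p ∈ e.baseSet := FiberBundle.mem_baseSet_trivializationAt' p
  have : ContMDiffVectorBundle 2 (EuclideanSpace ℝ (Fin m))
    (TangentSpace (𝓡 m) : M → Type _) (𝓡 m) :=
    have : IsManifold (𝓡 m) (2 + 1) M := .of_le (n := ∞) (WithTop.coe_le_coe.2 le_top)
    TangentBundle.contMDiffVectorBundle
  have hs (i) : SectionContMDiffAt 2 (e.localFrame b i) p := contMDiffAt_localFrame_of_mem 2 e b i hp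
  choose k hk hkV using fun i ↦ h _ (hs i)
  refine (mdifferentiableAt_iff_localFrameCoeff (I := 𝓡 m) (b := b) hp).2 fun i ↦ ?_
  -- The frame coefficients of `V` solve the linear system whose matrix is the Gram matrix of the
  -- frame and whose right-hand side consists of the products of `V` with the frame fields.
  refine mdifferentiableAt_of_mulVec_eq
    (A := fun q ↦ Matrix.of fun i j ↦ g.form q (e.localFrame b i q) (e.localFrame b j q))
    (c := fun q i ↦ e.localFrameCoeff (𝓡 m) b i q (V q)) (k := fun q i ↦ k i q)
    (fun i j ↦ g.mdifferentiableAt_inner ((hs i).mdifferentiableAt (by simp))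
      ((hs j).mdifferentiableAt (by simp))) hk ?_ ?_ i
  · simpa [hp] using! g.det_gram_ne_zero p (e.basisAt b hp)
  · filter_upwards [Filter.eventually_all.2 hkV,
      e.eventually_eq_localFrame_sum_coeff_smul (I := 𝓡 m) (s := V) b hp] with q hq hV
    ext i
    have := congrArg (g.form q (e.localFrame b i q)) hV
    rw [map_sum] at this
    rw [← hq i, inner, g.symm, this]
    simp [Matrix.mulVec, dotProduct, mul_comm]

/-- Being C² at `p` persists nearby, so the Koszul formula computes g(∇_X Y, Z) on a whole
neighbourhood and not only at `p`. -/
theorem diffAt_nabla {X Y : VField m M} {p : M} (hX : SectionContMDiffAt 2 X p)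
    (hY : SectionContMDiffAt 2 Y p) : DiffAt (g.nabla X Y) p := by
  have h2 : IsManifold (𝓡 m) 2 M := .of_le (n := ∞) two_le_infty
  refine g.diffAt_of_inner fun Z hZ ↦ ⟨fun q ↦ 2⁻¹ * g.koszul X Y Z q,
    mdifferentiableAt_const.mul (g.mdifferentiableAt_koszul hX hY hZ), ?_⟩
  have ev {S : VField m M} (hS : SectionContMDiffAt 2 S p) : ∀ᶠ q in nhds p, DiffAt S q :=
    ((contMDiffAt_iff_contMDiffAt_nhds (by simp)).1 hS).mono
      fun q hq ↦ hq.mdifferentiableAt (by simp)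
  filter_upwards [ev hX, ev hY, ev hZ] with q hX hY hZ
  have := g.two_mul_form_nablaAt hX hY hZ
  rw [← this, inv_mul_cancel_left₀ two_ne_zero]
  rfl

end PseudoRiemannianMetric

theorem SmoothNear.diffAt {X : VField m M} {p : M} (hX : SmoothNear X p) : DiffAt X p :=
  ContMDiffAt.mdifferentiableAt hX (by simp)

theorem SmoothNear.eventually_diffAt {X : VField m M} {p : M} (hX : SmoothNear X p) :
    ∀ᶠ q in nhds p, DiffAt X q :=
  hX.eventually_two.mono fun _ h ↦ h.mdifferentiableAt (by simp)

theorem DiffAt.sub {X Y : VField m M} {p : M} (hX : DiffAt X p) (hY : DiffAt Y p) :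
    DiffAt (X - Y) p :=
  mdifferentiableAt_sub_section hX hY

namespace AlmostComplexStructure

variable (J : AlmostComplexStructure m M)

theorem diffAt_app {X : VField m M} {p : M} (hX : DiffAt X p) : DiffAt (J.app X) p :=
  MDifferentiableAt.clm_bundle_apply (F₁ := EuclideanSpace ℝ (Fin m))
    (F₂ := EuclideanSpace ℝ (Fin m)) (J.smooth.mdifferentiableAt (by simp)) hX

theorem smoothNear_app {X : VField m M} {p : M} (hX : SmoothNear X p) :
    SmoothNear (J.app X) p :=
  ContMDiffAt.clm_bundle_apply (F₁ := EuclideanSpace ℝ (Fin m))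
    (F₂ := EuclideanSpace ℝ (Fin m)) (J.smooth p) hX

theorem app_app (X : VField m M) : J.app (J.app X) = -X :=
  funext fun p ↦ J.sq p _

theorem app_sub (X Y : VField m M) : J.app (X - Y) = J.app X - J.app Y :=
  funext fun p ↦ map_sub (J.endo p) _ _

end AlmostComplexStructure

/-! ### Algebra of ∇ and the second covariant derivative of J. -/

namespace PseudoRiemannianMetric

variable (g : PseudoRiemannianMetric m M) (J : AlmostComplexStructure m M)

/-- No differentiability is needed: where `Y` is not differentiable, neither is `-Y`, and both sides
take the default value 0. Signs can thus be pulled out of ∇ as an identity of fields. -/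
theorem leviCivita_neg (Y : VField m M) (p : M) : g.leviCivita (-Y) p = -g.leviCivita Y p := by
  by_cases hY : DiffAt Y p
  · simpa using g.leviCivita.isCovariantDerivativeOnUniv.smul_const (-1) hY
  · have hY' : ¬ DiffAt (-Y) p := fun h ↦ hY (by simpa using mdifferentiableAt_neg_section h)
    change g.nablaAt (-Y) p = -g.nablaAt Y p
    rw [nablaAt, nablaAt, dif_neg hY, dif_neg hY', neg_zero]

theorem leviCivita_sub {Y Z : VField m M} {p : M} (hY : DiffAt Y p) (hZ : DiffAt Z p) :
    g.leviCivita (Y - Z) p = g.leviCivita Y p - g.leviCivita Z p := by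
  rw [sub_eq_add_neg, sub_eq_add_neg, ← g.leviCivita_neg]
  exact g.leviCivita.isCovariantDerivativeOnUniv.add hY (mdifferentiableAt_neg_section hZ)

theorem nabla_sub {X Y Z : VField m M} {p : M} (hY : DiffAt Y p) (hZ : DiffAt Z p) :
    g.nabla X (Y - Z) p = g.nabla X Y p - g.nabla X Z p := by
  simp [nabla, g.leviCivita_sub hY hZ]

theorem nabla_neg (X Y : VField m M) : g.nabla X (-Y) = -g.nabla X Y := by
  ext1 p
  simp [nabla, g.leviCivita_neg]

theorem nabla_sub_nabla {X Y : VField m M} {p : M} (hX : DiffAt X p) (hY : DiffAt Y p) :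
    g.nabla X Y p - g.nabla Y X p = VectorField.mlieBracket (𝓡 m) X Y p :=
  (CovariantDerivative.torsion_eq_zero_iff _).1 g.torsion_leviCivita hX hY

/-- The second covariant derivative `(∇²_{X,Y} J) Z` of `J`. -/
noncomputable def nablaNablaJ (X Y Z : VField m M) : VField m M :=
  g.nabla X (g.nablaJ J Y Z) - g.nablaJ J (g.nabla X Y) Z - g.nablaJ J Y (g.nabla X Z)

theorem diffAt_nabla_of_smoothNear {X Y : VField m M} {p : M} (hX : SmoothNear X p)
    (hY : SmoothNear Y p) : DiffAt (g.nabla X Y) p :=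
  g.diffAt_nabla (hX.of_le two_le_infty) (hY.of_le two_le_infty)

theorem diffAt_nablaJ {X Y : VField m M} {p : M} (hX : SmoothNear X p)
    (hY : SmoothNear Y p) : DiffAt (g.nablaJ J X Y) p :=
  (g.diffAt_nabla_of_smoothNear hX (J.smoothNear_app hY)).sub
    (J.diffAt_app (g.diffAt_nabla_of_smoothNear hX hY))

/-- Metric compatibility expands the derivative of g((∇_Y J)Z, U), and the term containing ∇_X U
cancels. -/
theorem nablaF_eq {X Y Z U : VField m M} {p : M} (hX : SmoothNear X p) (hY : SmoothNear Y p)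
    (hZ : SmoothNear Z p) (hU : SmoothNear U p) :
    g.nablaF J X Y Z U p = g.inner (g.nablaNablaJ J X Y Z) U p := by
  have h := g.metric_leviCivita hX.diffAt (g.diffAt_nablaJ J hY hZ) hU.diffAt
  rw [nablaF, tensorF, h]
  simp only [inner, nablaNablaJ, tensorF, nabla, Pi.sub_apply, map_sub, sub_apply]
  ring

theorem nablaNablaJ_eq (X : VField m M) {Y Z : VField m M} {p : M}
    (hY : SmoothNear Y p) (hZ : SmoothNear Z p) :
    g.nablaNablaJ J X Y Z p =
      g.nabla X (g.nabla Y (J.app Z)) p - g.nabla X (J.app (g.nabla Y Z)) p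
      - g.nablaJ J (g.nabla X Y) Z p
      - (g.nabla Y (J.app (g.nabla X Z)) p - J.endo p (g.nabla Y (g.nabla X Z) p)) := by
  have := g.nabla_sub (X := X) (g.diffAt_nabla_of_smoothNear hY (J.smoothNear_app hZ))
    (J.diffAt_app (g.diffAt_nabla_of_smoothNear hY hZ))
  simp [nablaNablaJ, nablaJ, AlmostComplexStructure.app] at this ⊢
  rw [this]

/-! ### Self-adjointness of J and ∇J. -/

variable {g J}

/-- The Norden condition applied to `v` and Jw, with J² = -1. -/
theorem IsNorden.form_endo (hgJ : g.IsNorden J) (p : M) (v w : TangentSpace (𝓡 m) p) :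
    g.form p (J.endo p v) w = g.form p v (J.endo p w) := by
  have := hgJ p v (J.endo p w)
  rw [J.sq] at this
  simpa using this

theorem IsNorden.inner_app (hgJ : g.IsNorden J) (X Y : VField m M) :
    g.inner (J.app X) Y = g.inner X (J.app Y) :=
  funext fun p ↦ hgJ.form_endo p _ _

/-- The endomorphism `∇_X J` is self-adjoint. -/
theorem IsNorden.inner_nablaJ (hgJ : g.IsNorden J) {X Y Z : VField m M} {p : M}
    (hX : DiffAt X p) (hY : DiffAt Y p) (hZ : DiffAt Z p) :
    g.inner (g.nablaJ J X Y) Z p = g.inner Y (g.nablaJ J X Z) p := by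
  have h1 := g.metric_leviCivita hX (J.diffAt_app hY) hZ
  have h2 := g.metric_leviCivita hX hY (J.diffAt_app hZ)
  -- Now `h1` and `h2` are two expansions of the derivative of the same function g(JY, Z) = g(Y,
  -- JZ).
  rw [hgJ.inner_app] at h1
  have h3 := hgJ.form_endo p (g.leviCivita Y p (X p)) (Z p)
  have h4 := hgJ.form_endo p (Y p) (g.leviCivita Z p (X p))
  simp [inner, nablaJ, nabla, AlmostComplexStructure.app] at h1 h2 ⊢
  linarith

/-- The tensor `F` is symmetric in its last two arguments. -/
theorem IsNorden.tensorF_swap (hgJ : g.IsNorden J) {X Y Z : VField m M} {p : M}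
    (hX : DiffAt X p) (hY : DiffAt Y p) (hZ : DiffAt Z p) :
    g.tensorF J X Y Z p = g.tensorF J X Z Y p := by
  rw [tensorF, hgJ.inner_nablaJ hX hY hZ, g.inner_comm, tensorF]

/-- The tensor `∇_X F` is symmetric in its last two arguments. -/
theorem IsNorden.nablaF_swap (hgJ : g.IsNorden J) {X Y Z U : VField m M} {p : M}
    (hX : SmoothNear X p) (hY : SmoothNear Y p) (hZ : SmoothNear Z p) (hU : SmoothNear U p) :
    g.nablaF J X Y Z U p = g.nablaF J X Y U Z p := by
  -- The symmetry of F is needed on a neighbourhood, since it is about to be differentiated.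
  have h0 : g.tensorF J Y Z U =ᶠ[nhds p] g.tensorF J Y U Z := by
    filter_upwards [hY.eventually_diffAt, hZ.eventually_diffAt, hU.eventually_diffAt]
      with q hY hZ hU using hgJ.tensorF_swap hY hZ hU
  have h1 : mvfderiv (𝓡 m) (g.tensorF J Y Z U) p = mvfderiv (𝓡 m) (g.tensorF J Y U Z) p := by
    rw [mvfderiv, mvfderiv, h0.mfderiv_eq]
    rfl
  rw [nablaF, nablaF, h1,
    hgJ.tensorF_swap (g.diffAt_nabla_of_smoothNear hX hY) hZ.diffAt hU.diffAt,
    hgJ.tensorF_swap hY.diffAt (g.diffAt_nabla_of_smoothNear hX hZ) hU.diffAt,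
    hgJ.tensorF_swap hY.diffAt hZ.diffAt (g.diffAt_nabla_of_smoothNear hX hU)]
  ring

/-! ### Second-order identities for J and their consequences for F and R. -/

/-- The Ricci identity for `J`. -/
theorem nablaNablaJ_sub_nablaNablaJ {X Y Z : VField m M} {p : M} (hX : SmoothNear X p)
    (hY : SmoothNear Y p) (hZ : SmoothNear Z p) :
    g.nablaNablaJ J X Y Z p - g.nablaNablaJ J Y X Z p
      = g.curvature X Y (J.app Z) p - J.endo p (g.curvature X Y Z p) := by
  have hb := g.nabla_sub_nabla hX.diffAt hY.diffAt
  rw [g.nablaNablaJ_eq J X hY hZ, g.nablaNablaJ_eq J Y hX hZ]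
  simp only [curvature, Pi.sub_apply, map_sub, nablaJ, AlmostComplexStructure.app]
  -- ∇W is linear in its direction at `p`, so vanishing torsion splits the bracket term of the
  -- curvature into the two first-order terms of ∇²J.
  have h (W : VField m M) : g.nabla (VectorField.mlieBracket (𝓡 m) X Y) W p
      = g.nabla (g.nabla X Y) W p - g.nabla (g.nabla Y X) W p := by
    simp only [nabla] at hb ⊢
    rw [← map_sub, hb]
  rw [h, h, map_sub]
  abel

/-- The second derivative of `J² = -1`. -/
theorem nablaNablaJ_app_add {X Y Z : VField m M} {p : M} (hX : SmoothNear X p)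
    (hY : SmoothNear Y p) (hZ : SmoothNear Z p) :
    g.nablaNablaJ J X Y (J.app Z) p + J.endo p (g.nablaNablaJ J X Y Z p)
      = -g.nablaJ J X (g.nablaJ J Y Z) p - g.nablaJ J Y (g.nablaJ J X Z) p := by
  have h {A B : VField m M} (hB : SmoothNear B p) :
      g.nablaJ J A (g.nablaJ J B Z) p
        = g.nabla A (J.app (g.nabla B (J.app Z))) p + g.nabla A (g.nabla B Z) p
          - J.endo p (g.nabla A (g.nabla B (J.app Z)) p)
          + J.endo p (g.nabla A (J.app (g.nabla B Z)) p) := by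
    have d1 := g.diffAt_nabla_of_smoothNear hB (J.smoothNear_app hZ)
    have d2 := g.diffAt_nabla_of_smoothNear hB hZ
    -- By J² = -1, J(∇_B J)Z is J∇_B(JZ) - (-∇_B Z), hence the negated field.
    have e1 := g.nabla_sub (X := A) (J.diffAt_app d1) (mdifferentiableAt_neg_section d2)
    have e2 := g.nabla_sub (X := A) d1 (J.diffAt_app d2)
    rw [nablaJ, nablaJ, J.app_sub, J.app_app, Pi.sub_apply]
    refine (congrArg₂ _ e1 (congrArg (J.endo p) e2)).trans ?_
    have e3 := congrFun (g.nabla_neg A (g.nabla B Z)) p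
    refine (congrArg₂ _ (congrArg₂ _ rfl e3) rfl).trans ?_
    rw [map_sub, Pi.neg_apply]
    abel
  rw [g.nablaNablaJ_eq J X hY (J.smoothNear_app hZ), g.nablaNablaJ_eq J X hY hZ,
    h hY, h hX, J.app_app, nabla_neg, nabla_neg]
  -- With W = ∇_X Y, the terms (∇_W J)JZ + J(∇_W J)Z cancel: this is J² = -1 differentiated once.
  simp only [nablaJ, J.app_app, nabla_neg, AlmostComplexStructure.app, map_sub, Pi.sub_apply,
    Pi.neg_apply, J.sq]
  abel

theorem IsNorden.curvature4_app_sub (hgJ : g.IsNorden J) {X Y Z U : VField m M} {p : M}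
    (hX : SmoothNear X p) (hY : SmoothNear Y p) (hZ : SmoothNear Z p) (hU : SmoothNear U p) :
    g.curvature4 X Y (J.app Z) U p - g.curvature4 X Y Z (J.app U) p
      = g.nablaF J X Y Z U p - g.nablaF J Y X Z U p := by
  rw [g.nablaF_eq J hX hY hZ hU, g.nablaF_eq J hY hX hZ hU, curvature4, curvature4,
    ← hgJ.inner_app]
  have h := congrArg (fun v ↦ g.form p v (U p)) (nablaNablaJ_sub_nablaNablaJ (g := g) (J := J) hX hY hZ)
  simpa [inner, AlmostComplexStructure.app] using h.symm

/-- Pair `nablaNablaJ_app_add` with `U`; in each product the outer factor, ∇_X J or ∇_Y J, moves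
onto `U` by self-adjointness. -/
theorem IsNorden.nablaF_app_add (hgJ : g.IsNorden J) {X Y Z U : VField m M} {p : M}
    (hX : SmoothNear X p) (hY : SmoothNear Y p) (hZ : SmoothNear Z p) (hU : SmoothNear U p) :
    g.nablaF J X Y (J.app Z) U p + g.nablaF J X Y Z (J.app U) p
      = -g.inner (g.nablaJ J X Z) (g.nablaJ J Y U) p
        - g.inner (g.nablaJ J X U) (g.nablaJ J Y Z) p := by
  rw [g.nablaF_eq J hX hY (J.smoothNear_app hZ) hU, g.nablaF_eq J hX hY hZ (J.smoothNear_app hU),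
    ← hgJ.inner_app, ← hgJ.inner_nablaJ hY.diffAt (g.diffAt_nablaJ J hX hZ) hU.diffAt,
    g.inner_comm (g.nablaJ J X U),
    ← hgJ.inner_nablaJ hX.diffAt (g.diffAt_nablaJ J hY hZ) hU.diffAt]
  have h := congrArg (fun v ↦ g.form p v (U p)) (nablaNablaJ_app_add (g := g) (J := J) hX hY hZ)
  simp only [map_add, map_sub, map_neg, add_apply, sub_apply, neg_apply] at h
  simp only [inner, AlmostComplexStructure.app]
  linarith

theorem inverseGram_symm {ι : Type*} [Fintype ι] [DecidableEq ι] (p : M)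
    (e : Module.Basis ι ℝ (TangentSpace (𝓡 m) p)) (i j : ι) :
    g.inverseGram p e i j = g.inverseGram p e j i := by
  have h : (Matrix.of fun i j ↦ g.form p (e i) (e j)).IsSymm :=
    Matrix.IsSymm.ext fun i j ↦ g.symm p _ _
  exact h.inv.apply j i

/-- Exchanging i and j swaps the two terms on the right of `nablaF_app_add` and preserves g^{ij}, so
they contribute equally; hence the factor 2. -/
theorem IsNorden.sum_inverseGram_mul_nablaF (hgJ : g.IsNorden J) {ι : Type*} [Fintype ι]
    [DecidableEq ι] {p : M} (e : Module.Basis ι ℝ (TangentSpace (𝓡 m) p))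
    {E : ι → VField m M} {Z U : VField m M} (hE : ∀ i, SmoothNear (E i) p)
    (hZ : SmoothNear Z p) (hU : SmoothNear U p) :
    ∑ i, ∑ j, g.inverseGram p e i j * g.nablaF J (E i) (E j) (J.app Z) U p
        + ∑ i, ∑ j, g.inverseGram p e i j * g.nablaF J (E i) (E j) Z (J.app U) p
      = -2 * ∑ i, ∑ j, g.inverseGram p e i j
          * g.inner (g.nablaJ J (E i) Z) (g.nablaJ J (E j) U) p := by
  have h1 : ∑ i, ∑ j, g.inverseGram p e i j
        * g.inner (g.nablaJ J (E i) U) (g.nablaJ J (E j) Z) p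
      = ∑ i, ∑ j, g.inverseGram p e i j
        * g.inner (g.nablaJ J (E i) Z) (g.nablaJ J (E j) U) p := by
    rw [Finset.sum_comm]
    refine Finset.sum_congr rfl fun i _ ↦ Finset.sum_congr rfl fun j _ ↦ ?_
    rw [inverseGram_symm, g.inner_comm]
  simp only [← Finset.sum_add_distrib, ← mul_add, hgJ.nablaF_app_add (hE _) (hE _) hZ hU,
    mul_sub, mul_neg, Finset.sum_sub_distrib, Finset.sum_neg_distrib, h1]
  ring

end PseudoRiemannianMetric

end

theorem theoremt1 (n : ℕ) (M : Type*) [TopologicalSpace M]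
    [ChartedSpace (EuclideanSpace ℝ (Fin (2 * n))) M] [IsManifold (𝓡 (2 * n)) ∞ M]
    (g : PseudoRiemannianMetric (2 * n) M) (J : AlmostComplexStructure (2 * n) M)
    (hgJ : g.IsNorden J) (p : M) :
    (∀ X Y Z U : VField (2 * n) M,
      SmoothNear X p → SmoothNear Y p → SmoothNear Z p → SmoothNear U p →
      g.curvature4 X Y (J.app Z) U p - g.curvature4 X Y Z (J.app U) p
        = g.nablaF J X Y Z U p - g.nablaF J Y X Z U p) ∧
    (∀ X Y Z U : VField (2 * n) M,
      SmoothNear X p → SmoothNear Y p → SmoothNear Z p → SmoothNear U p →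
      g.nablaF J X Y (J.app Z) U p + g.nablaF J X Y Z (J.app U) p
        = -g.inner (g.nablaJ J X Z) (g.nablaJ J Y U) p
          - g.inner (g.nablaJ J X U) (g.nablaJ J Y Z) p) ∧
    (∀ X Y Z U : VField (2 * n) M,
      SmoothNear X p → SmoothNear Y p → SmoothNear Z p → SmoothNear U p →
      g.nablaF J X Y Z U p = g.nablaF J X Y U Z p) ∧
    -- the tensors are evaluated on tangent vectors by means of arbitrary smooth local extensions
    (∀ (e : Module.Basis (Fin (2 * n)) ℝ (TangentSpace (𝓡 (2 * n)) p))
      (z u : TangentSpace (𝓡 (2 * n)) p)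
      (E : Fin (2 * n) → VField (2 * n) M) (Z U : VField (2 * n) M),
      (∀ i, SmoothNear (E i) p) → (∀ i, E i p = e i) →
      SmoothNear Z p → Z p = z → SmoothNear U p → U p = u →
      ∑ i, ∑ j, g.inverseGram p e i j * g.nablaF J (E i) (E j) (J.app Z) U p
          + ∑ i, ∑ j, g.inverseGram p e i j * g.nablaF J (E i) (E j) Z (J.app U) p
        = -2 * ∑ i, ∑ j, g.inverseGram p e i j
            * g.inner (g.nablaJ J (E i) Z) (g.nablaJ J (E j) U) p) :=
  ⟨fun _ _ _ _ hX hY hZ hU ↦ hgJ.curvature4_app_sub hX hY hZ hU,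
    fun _ _ _ _ hX hY hZ hU ↦ hgJ.nablaF_app_add hX hY hZ hU,
    fun _ _ _ _ hX hY hZ hU ↦ hgJ.nablaF_swap hX hY hZ hU,
    fun e _ _ _ _ _ hE _ hZ _ hU _ ↦ hgJ.sum_inverseGram_mul_nablaF e hE hZ hU⟩
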